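/- **Setting.** Consider $\min_{x\in\mathbb R^d} F(x)=\sum_{i=1}^M\alpha_i f_i(x)+r(x)$, where $\alpha_i\ge 0$, $\sum_i\alpha_i=1$, the functions $f_i:\mathbb R^d\to\mathbb R$ are $\mu$-strongly convex ($\mu\ge 0$) and $L$-smooth, and $r:\mathbb R^d\to\mathbb R\cup\{+\infty\}$ is proper, convex and lower semicontinuous. If $\mu=0$, assume that $F$ has a minimizer. Let $0<c\le d$, $\delta\in(0,1)$, $\pi=c/d$, $\alpha=c/(2d)$, $\kappa=\frac{1-\sqrt{\pi-\alpha}}{1+\sqrt{\pi-\alpha}}$, $\rho=\frac{\kappa L-\mu}{1-\kappa}$, assumed positive, and $\gamma\in\big(0,\frac{2}{\mu+L+2\rho}\big]$. **Spy** (inner solver) on $((\alpha_i),(h_i),r;p)$. Masks $\mathbf S^0,\mathbf S^1,\dots\subseteq\{1,\dots,d\}$ are drawn i.i.d. with $\mathbb P[j\in\mathbf S^k]=p_j$. The agents answer in an arbitrary asynchronous order, with no assumption on the delays. When agent $i$ answers at time $k$, the coordinates of its local variable $x_i$ in the mask that it had last received are replaced by those of $x-\gamma\nabla h_i(x)$,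 where $x$ is the coordinator point that it had last received; then $x^k=\mathbf{prox}_{\gamma r}(\sum_j\alpha_jx_j)$ is computed and sent to agent $i$ together with $\mathbf S^k$. The initial points are arbitrary. **Catalyst-Spy.** Start from $y_1=x_1$. At outer iteration $\ell\ge1$ let $h_{i,\ell}=f_i+\frac\rho2\|\cdot-y_\ell\|^2$, $H_\ell=\sum_i\alpha_ih_{i,\ell}+r$, and $p_{j,\ell}=\min(c/|\mathrm{null}(y_\ell)|,1)$ if $(y_\ell)_{[j]}=0$, $p_{j,\ell}=1$ otherwise, where $\mathrm{null}(y)=\{j: y_{[j]}=0\}$. Run Spy on $((\alpha_i),(h_{i,\ell}),r;p_\ell)$ and let $x_{\ell+1}$ be its first point that satisfies the chosen criterion: - $\mathsf C'_2$: $H_\ell(x_{\ell+1})-\min H_\ell\le \theta_\ell\,\frac{2(F(y_1)-\min F)}{9}$ with $\theta_\ell=\Big(1-\sqrt{\tfrac{\mu}{4(\mu+\rho)}}\Big)^\ell$ if $\mu>0$ and $\theta_\ell=\ell^{-(4+\delta)}$ if $\mu=0$ (here $F(x_1)<+\infty$ is assumed); - $\mathsf C'_3$: $H_\ell(x_{\ell+1})-\min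 H_\ell\le \theta'_\ell\,\frac{\rho\|x_{\ell+1}-y_\ell\|^2}{2}$ with $\theta'_\ell=\frac{\sqrt\mu}{2\sqrt{\mu+\rho}-\sqrt\mu}$ if $\mu>0$ and $\theta'_\ell=\ell^{-2}$ if $\mu=0$. Then $y_{\ell+1}=x_{\ell+1}+\beta_\ell(x_{\ell+1}-x_\ell)$, where $\beta_\ell=\frac{a_{\ell-1}(1-a_{\ell-1})}{a_{\ell-1}^2+a_\ell}$, $a_\ell>0$ solves $a_\ell^2=(1-a_\ell)a_{\ell-1}^2+q\,a_\ell$ with $q=\frac{\mu}{\mu+\rho}$, and $a_0=\sqrt q$ if $\mu>0$, $a_0=1$ if $\mu=0$. **Theorem.** Under either criterion, in every realization there is a constant $C$ such that, for all $\ell\ge1$ for which the inner loops $1,\dots,\ell$ stop (so that $x_{\ell+1}$ is defined), $$F(x_{\ell+1})-\min F\le \frac{C}{\ell^2}.$$ If $\mu>0$ or if $\mathsf C'_2$ is used, $C$ can be chosen independently of the realization. Furthermore, if $\mu>0$, then $F$ has a unique minimizer $x^\star$, and there is a constant $C$ independent of the realization such that, for all such $\ell$, $$\|x_{\ell+1}-x^\star\|^2\le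 C\left(1-\sqrt{\frac{\mu}{4\mu+4\rho}}\right)^{\ell}.$$ -/

import Mathlib

open MeasureTheory
open scoped BigOperators

noncomputable section

/-- The ambient space `ℝᵈ` with its Euclidean norm. -/
abbrev Vec (d : ℕ) := EuclideanSpace ℝ (Fin d)

/-- `F(x) = ∑ᵢ αᵢ fᵢ(x) + r(x)`, with values in `ℝ ∪ {+∞}` (inside `EReal`). -/
def objective {d M : ℕ} (a : Fin M → ℝ) (f : Fin M → Vec d → ℝ) (r : Vec d → EReal)
    (x : Vec d) : EReal :=
  ((∑ i, a i * f i x : ℝ) : EReal) + r x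

/-- The regularized local functions `hᵢ = fᵢ + (ρ/2) ‖· - y‖²`. -/
def regularized {d M : ℕ} (f : Fin M → Vec d → ℝ) (ρ : ℝ) (y : Vec d) (i : Fin M)
    (x : Vec d) : ℝ :=
  f i x + ρ / 2 * ‖x - y‖ ^ 2

/-- `x` is a global minimizer of `g`. -/
def IsMinimizer {d : ℕ} (g : Vec d → EReal) (x : Vec d) : Prop := ∀ z, g x ≤ g z

/-- `prox_g(v) = argmin_u { g(u) + ½ ‖u - v‖² }` (the minimizer exists and is unique when `g` is
proper, convex and lower semicontinuous). -/
def prox {d : ℕ} (g : Vec d → EReal) (v : Vec d) : Vec d :=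
  Classical.epsilon (IsMinimizer fun u => g u + ((1 / 2 * ‖u - v‖ ^ 2 : ℝ) : EReal))

/-- Convexity of an extended-real-valued function: its epigraph is convex. -/
def EpiConvex {d : ℕ} (g : Vec d → EReal) : Prop :=
  Convex ℝ {p : Vec d × ℝ | g p.1 ≤ (p.2 : EReal)}

/-- `L`-smoothness: differentiable with `L`-Lipschitz gradient. -/
def IsSmooth {d : ℕ} (L : ℝ) (f : Vec d → ℝ) : Prop :=
  Differentiable ℝ f ∧ ∀ x y, ‖gradient f x - gradient f y‖ ≤ L * ‖x - y‖

/-! ### The inner solver Spy -/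

/-- The vector that agrees with `u` on the coordinates in `S` and with `v` elsewhere. -/
def mergeOn {d : ℕ} (S : Finset (Fin d)) (u v : Vec d) : Vec d :=
  WithLp.toLp 2 fun j => if j ∈ S then u j else v j

/-- State of Spy: the local variables `xᵢ` of the workers, the last pair (point, mask) that the
coordinator has sent to each worker, and the current coordinator point `xᵏ`. -/
structure SpyState (d M : ℕ) where
  loc : Fin M → Vec d
  sent : Fin M → Vec d × Finset (Fin d)
  point : Vec d

/-- One iteration of Spy on `((αᵢ), (hᵢ), r)` with stepsize `γ`. The coordinator receives the update
of agent `i`, which was computed from the pair `(x, S)` previously sent to `i`, so that `xᵢ` becomes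
`x - γ ∇hᵢ(x)` on the coordinates in `S` and is unchanged elsewhere. The coordinator then computes
`prox_{γ r}(∑ⱼ αⱼ xⱼ)` and sends it to `i` together with the new mask `T`. -/
def spyStep {d M : ℕ} (γ : ℝ) (a : Fin M → ℝ) (h : Fin M → Vec d → ℝ) (r : Vec d → EReal)
    (i : Fin M) (T : Finset (Fin d)) (s : SpyState d M) : SpyState d M :=
  let x := (s.sent i).1
  let S := (s.sent i).2
  let loc' := Function.update s.loc i (mergeOn S (x - γ • gradient (h i) x) (s.loc i))
  let x' := prox (fun u => (γ : EReal) * r u) (∑ j, a j • loc' j)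
  { loc := loc', sent := Function.update s.sent i (x', T), point := x' }

/-- The states of Spy, from the initial point `x⁰` and initial local variables `xᵢ⁰`, for the masks
`S⁰, S¹, …` and the sequence `i¹, i², …` of responding agents (arbitrary, so the delays are). -/
def spy {d M : ℕ} (γ : ℝ) (a : Fin M → ℝ) (h : Fin M → Vec d → ℝ) (r : Vec d → EReal)
    (x0 : Vec d) (loc0 : Fin M → Vec d) (agent : ℕ → Fin M) (mask : ℕ → Finset (Fin d)) :
    ℕ → SpyState d M
  | 0 => { loc := loc0, sent := fun _ => (x0, mask 0), point := x0 }
  | k + 1 => spyStep γ a h r (agent (k + 1)) (mask (k + 1))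
      (spy γ a h r x0 loc0 agent mask k)

/-- Everything in the execution that the algorithm does not determine itself: for the outer loop
`ℓ`, the masks `S⁰, S¹, …`, the responding agents `i¹, i², …`, and the initialization of Spy. -/
structure Execution (d M : ℕ) where
  mask : ℕ → ℕ → Finset (Fin d)
  agent : ℕ → ℕ → Fin M
  init : ℕ → Vec d × (Fin M → Vec d)

/-! ### Catalyst-Spy -/

/-- The two stopping criteria of the inner loop: `absolute` is `C'₂`, `relative` is `C'₃`. -/
inductive StoppingRule
  | absolute
  | relative

/-- The input of Catalyst-Spy: the problem `((αᵢ), (fᵢ), r)`, the constants `μ`, `L`, the parameters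
`c`, `δ`, the stepsize `γ`, the initial point `x₁`, and the stopping criterion. -/
structure CatalystSpy (d M : ℕ) where
  a : Fin M → ℝ
  f : Fin M → Vec d → ℝ
  r : Vec d → EReal
  μ : ℝ
  L : ℝ
  c : ℝ
  δ : ℝ
  γ : ℝ
  x₁ : Vec d
  rule : StoppingRule

namespace CatalystSpy

variable {d M : ℕ} (D : CatalystSpy d M)

/-- The objective `F`. -/
def F : Vec d → EReal := objective D.a D.f D.r

/-- `κ = (1 - √(π - α)) / (1 + √(π - α))` with `π = c / d` and `α = c / (2 d)`. -/
def κ : ℝ :=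
  (1 - √(D.c / d - D.c / (2 * d))) / (1 + √(D.c / d - D.c / (2 * d)))

/-- The reconditioning parameter `ρ = (κ L - μ) / (1 - κ)`. -/
def ρ : ℝ := (D.κ * D.L - D.μ) / (1 - D.κ)

/-- The objective `H(x) = ∑ᵢ αᵢ (fᵢ(x) + (ρ/2) ‖x - y‖²) + r(x)` of the reconditioned problem with
center `y`. -/
def H (y : Vec d) : Vec d → EReal := objective D.a (regularized D.f D.ρ y) D.r

/-- The selection probabilities computed from the support of `y`: `min (c / |null y|) 1` for a
coordinate in `null y`, and `1` otherwise. -/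
def prob (y : Vec d) (j : Fin d) : ℝ :=
  if y j = 0 then min (D.c / (Finset.univ.filter fun i => y i = 0).card) 1 else 1

/-- `q = μ / (μ + ρ)`. -/
def q : ℝ := D.μ / (D.μ + D.ρ)

/-- The Catalyst sequence: `α₀ = √q` if `μ > 0` and `α₀ = 1` if `μ = 0`; then `αₖ₊₁` is the positive
root of `t² = (1 - t) αₖ² + q t`. -/
def alpha : ℕ → ℝ
  | 0 => if 0 < D.μ then √D.q else 1
  | k + 1 => (D.q - alpha k ^ 2 + √((D.q - alpha k ^ 2) ^ 2 + 4 * alpha k ^ 2)) / 2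

/-- The inertial parameters `βₖ = αₖ₋₁ (1 - αₖ₋₁) / (αₖ₋₁² + αₖ)` for `k ≥ 1`. -/
def beta : ℕ → ℝ
  | 0 => 0
  | k + 1 => D.alpha k * (1 - D.alpha k) / (D.alpha k ^ 2 + D.alpha (k + 1))

/-- The factor in front of `2 (F(y₁) - min F) / 9` in the criterion `C'₂`. -/
def absFactor (ℓ : ℕ) : ℝ :=
  if 0 < D.μ then (1 - √(D.μ / (4 * (D.μ + D.ρ)))) ^ ℓ else 1 / (ℓ : ℝ) ^ (4 + D.δ)

/-- The factor in front of `ρ ‖x_{ℓ+1} - y_ℓ‖² / 2` in the criterion `C'₃`. -/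
def relFactor (ℓ : ℕ) : ℝ :=
  if 0 < D.μ then √D.μ / (2 * √(D.μ + D.ρ) - √D.μ) else 1 / (ℓ : ℝ) ^ 2

/-- The stopping test of the inner loop at the outer iteration `ℓ` with center `y = y_ℓ`, for the
candidate `x` (here `y₁ = x₁`). -/
def StopTest (ℓ : ℕ) (y x : Vec d) : Prop :=
  match D.rule with
  | .absolute =>
      D.H y x - ⨅ z, D.H y z ≤
        ((D.absFactor ℓ * (2 / 9) : ℝ) : EReal) * (D.F D.x₁ - ⨅ z, D.F z)
  | .relative =>
      D.H y x - ⨅ z, D.H y z ≤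
        ((D.relFactor ℓ * (D.ρ * ‖x - y‖ ^ 2 / 2) : ℝ) : EReal)

/-- The `k`-th point of Spy on `((αᵢ), (h_{i,ℓ}), r)` in the outer loop `ℓ` with center `y`. -/
def innerPoint (w : Execution d M) (ℓ : ℕ) (y : Vec d) (k : ℕ) : Vec d :=
  (spy D.γ D.a (regularized D.f D.ρ y) D.r (w.init ℓ).1 (w.init ℓ).2 (w.agent ℓ) (w.mask ℓ)
    k).point

/-- The output of the inner loop: the first Spy point that passes the test. -/
def innerOutput (w : Execution d M) (ℓ : ℕ) (y : Vec d) : Vec d :=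
  D.innerPoint w ℓ y (sInf {k | D.StopTest ℓ y (D.innerPoint w ℓ y k)})

/-- The pair `(x_ℓ, y_ℓ)` for `ℓ ≥ 1` (the value at `0` is not used): `y₁ = x₁`, then `x_{ℓ+1}` is
the output of the inner loop `ℓ` with center `y_ℓ`, and
`y_{ℓ+1} = x_{ℓ+1} + β_ℓ (x_{ℓ+1} - x_ℓ)`. -/
def iter (w : Execution d M) : ℕ → Vec d × Vec d
  | 0 => (D.x₁, D.x₁)
  | 1 => (D.x₁, D.x₁)
  | n + 2 =>
      let s := iter w (n + 1)
      let x' := D.innerOutput w (n + 1) s.2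
      (x', x' + D.beta (n + 1) • (x' - s.1))

/-- The outer iterate `x_ℓ`. -/
def X (w : Execution d M) (ℓ : ℕ) : Vec d := (D.iter w ℓ).1

/-- The extrapolated iterate `y_ℓ`. -/
def Y (w : Execution d M) (ℓ : ℕ) : Vec d := (D.iter w ℓ).2

/-- The inner loops `1, …, ℓ` all stop, so that the algorithm has produced `x_{ℓ+1}`. -/
def Produces (w : Execution d M) (ℓ : ℕ) : Prop :=
  ∀ m, 1 ≤ m → m ≤ ℓ → ∃ k, D.StopTest m (D.Y w m) (D.innerPoint w m (D.Y w m) k)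

end CatalystSpy

/-- The σ-algebra generated by the masks drawn before the `k`-th mask of the outer loop `ℓ`. -/
abbrev history {Ω : Type*} {d M : ℕ} (W : Ω → Execution d M) (ℓ k : ℕ) : MeasurableSpace Ω :=
  MeasurableSpace.generateFrom
    {B | ∃ m n A, (m < ℓ ∨ (m = ℓ ∧ n < k)) ∧ B = {ω | (W ω).mask m n = A}}

/-- The random executions of Catalyst-Spy. The responding agents and the initializations may depend
on the masks drawn before. In the outer loop `ℓ` the masks are i.i.d. given the past, with a law `ν`
on the subsets of the coordinates that is fixed at the beginning of the loop and under which the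
coordinate `j` is selected with the probability `p_{j,ℓ}` computed from the support of `y_ℓ`. -/
structure CatalystSpy.IsRandomExecution {d M : ℕ} (D : CatalystSpy d M) {Ω : Type*}
    [MeasurableSpace Ω] (P : Measure Ω) (W : Ω → Execution d M) : Prop where
  measurable_mask : ∀ ℓ k A, MeasurableSet {ω | (W ω).mask ℓ k = A}
  measurable_agent : ∀ ℓ k, Measurable[history W ℓ k] fun ω => (W ω).agent ℓ k
  measurable_init : ∀ ℓ, Measurable[history W ℓ 0] fun ω => (W ω).init ℓ
  law : ∃ ν : ℕ → Finset (Fin d) → Ω → ℝ,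
    (∀ ℓ A, Measurable[history W ℓ 0] (ν ℓ A)) ∧
    (∀ ℓ k A, 1 ≤ ℓ →
      P[{ω | (W ω).mask ℓ k = A}.indicator (fun _ => (1 : ℝ)) | history W ℓ k] =ᵐ[P] ν ℓ A) ∧
    (∀ ℓ j, 1 ≤ ℓ → ∀ᵐ ω ∂P,
      ∑ A ∈ Finset.univ.filter (fun A => j ∈ A), ν ℓ A ω = D.prob (D.Y (W ω) ℓ) j)

end

/-! ### Scalar recursions with errors. -/

section SequenceBounds

/-! The argument is pathwise: an inner loop enters only through the stopping test passed by its
output, which makes the outer loop an accelerated inexact proximal point method. Strong convexity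
turns each test into a three-point inequality that loses a fraction `t` of its quadratic term and
gains an absolute error `e` (`ApproxStep`). Tested at a convex combination of the current iterate
and a minimizer, it gives `(1 - t) Φ' ≤ (1 - b) Φ + e` for the Lyapunov function (`lyapunov_step`);
the inertial parameter is exactly the one that closes this recursion (`extrapolation_sq_norm_le`).
If `μ > 0`, then `b = √q` at every step, and the choice of `t` leaves the rate `1 - √q / 2`. If `μ =
0`, then `1 - b = b² / a²`, so `Φ / a²` grows only through summable perturbations, while `a` decays
like `1 / ℓ`. -/

theorem le_mul_geometric_of_contraction {u : ℕ → ℝ} {s r c B : ℝ} {n : ℕ} (hs : 0 ≤ s)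
    (hr : 0 ≤ r) (h0 : u 0 ≤ B) (hB : c * r ≤ B * (r - s))
    (h : ∀ k < n, u (k + 1) ≤ s * u k + c * r ^ (k + 1)) :
    ∀ k ≤ n, u k ≤ B * r ^ k := by
  intro k
  induction k with
  | zero => intro _; simpa using h0
  | succ k ih =>
    intro hk
    have h1 := mul_le_mul_of_nonneg_left (ih (by omega)) hs
    -- `hB` says that the bound reproduces itself: `s B + c r ≤ B r`.
    have h2 := mul_le_mul_of_nonneg_right hB (pow_nonneg hr k)
    have h3 := h k (by omega)
    rw [pow_succ] at h3 ⊢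
    nlinarith

/-- A discrete Grönwall argument: for `t ≤ 1/2` the factor `1 / (1 - t)` is at most `exp (2 t)`, so
the product of these factors is controlled by the sum of the `t k`. -/
theorem le_of_perturbed_contraction {u t e : ℕ → ℝ} {B St Se : ℝ} {n : ℕ} (hB : 0 ≤ B)
    (h0 : u 0 ≤ B) (ht : ∀ k, 0 ≤ t k) (ht' : ∀ k, t k ≤ 1 / 2) (he : ∀ k, 0 ≤ e k)
    (hSt : ∀ k, ∑ j ∈ Finset.range k, t j ≤ St) (hSe : ∀ k, ∑ j ∈ Finset.range k, e j ≤ Se)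
    (h : ∀ k < n, (1 - t k) * u (k + 1) ≤ u k + e k) :
    ∀ k ≤ n, u k ≤ Real.exp (2 * St) * (B + Se) := by
  have key : ∀ k ≤ n, u k ≤ Real.exp (2 * ∑ j ∈ Finset.range k, t j) *
      (B + ∑ j ∈ Finset.range k, e j) := by
    intro k
    induction k with
    | zero => intro _; simpa using h0
    | succ k ih =>
      intro hk
      have h1 := h k (by omega)
      have h2 := ih (by omega)
      rw [Finset.sum_range_succ, Finset.sum_range_succ, mul_add (2 : ℝ), Real.exp_add]
      set G := Real.exp (2 * ∑ j ∈ Finset.range k, t j)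
      set Z := ∑ j ∈ Finset.range k, e j
      have hZ : 0 ≤ Z := Finset.sum_nonneg fun j _ => he j
      have hG : 1 ≤ G := Real.one_le_exp
        (mul_nonneg zero_le_two (Finset.sum_nonneg fun j _ => ht j))
      have hx : 1 + 2 * t k ≤ Real.exp (2 * t k) := by
        have := Real.add_one_le_exp (2 * t k); linarith
      have h3 : 1 ≤ (1 - t k) * Real.exp (2 * t k) := by
        have := mul_le_mul_of_nonneg_left hx (show 0 ≤ 1 - t k by linarith [ht' k])
        nlinarith [ht k, ht' k]
      have h4 : u k + e k ≤ G * (B + (Z + e k)) := by nlinarith [he k]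
      have h5 : 0 ≤ G * (B + (Z + e k)) := by
        have := he k
        positivity
      have h6 : (1 - t k) * u (k + 1) ≤
          (1 - t k) * (G * Real.exp (2 * t k) * (B + (Z + e k))) := by nlinarith
      exact le_of_mul_le_mul_left h6 (by linarith [ht' k])
  intro k hk
  refine (key k hk).trans ?_
  have : 0 ≤ ∑ j ∈ Finset.range k, e j := Finset.sum_nonneg fun j _ => he j
  have := hSe k
  gcongr
  exact hSt k

theorem exists_geometric_le_div_sq {r : ℝ} (hr : 0 ≤ r) (hr1 : r < 1) :
    ∃ C : ℝ, 0 ≤ C ∧ ∀ n : ℕ, r ^ n ≤ C / ((n : ℝ) + 1) ^ 2 := by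
  have h : Filter.Tendsto (fun n : ℕ => ((n : ℝ) + 1) ^ 2 * r ^ n) Filter.atTop (nhds 0) := by
    have h2 := tendsto_pow_const_mul_const_pow_of_lt_one 2 hr hr1
    have h1 := tendsto_pow_const_mul_const_pow_of_lt_one 1 hr hr1
    have h0 := tendsto_pow_const_mul_const_pow_of_lt_one 0 hr hr1
    have := (h2.add (h1.const_mul 2)).add h0
    simp only [mul_zero, add_zero] at this
    refine this.congr fun n => ?_
    ring
  obtain ⟨C, hC⟩ := h.bddAbove_range
  refine ⟨max C 0, le_max_right _ _, fun n => ?_⟩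
  rw [le_div_iff₀ (by positivity), mul_comm]
  exact (hC ⟨n, rfl⟩).trans (le_max_left _ _)

end SequenceBounds

/-! ### Inexact proximal steps and the Lyapunov function. -/

section InexactProximalStep

variable {V : Type*} [NormedAddCommGroup V] [InnerProductSpace ℝ V]

/-- `x` minimizes `g + (ρ/2) ‖· - y‖²` over `S` up to `ε`. -/
def InexactProx (S : Set V) (g : V → ℝ) (ρ : ℝ) (y x : V) (ε : ℝ) : Prop :=
  x ∈ S ∧ ∀ z ∈ S, g x + ρ / 2 * ‖x - y‖ ^ 2 ≤ g z + ρ / 2 * ‖z - y‖ ^ 2 + ε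

/-- The three-point inequality of a proximal step from `y` to `x`, relaxed by the relative error
`t` and the absolute error `e`. -/
def ApproxStep (S : Set V) (g : V → ℝ) (μ ρ : ℝ) (y x : V) (t e : ℝ) : Prop :=
  x ∈ S ∧ ∀ z ∈ S, g x + (1 - t) * ((μ + ρ) / 2 * ‖z - x‖ ^ 2) ≤
    g z + ρ / 2 * ‖z - y‖ ^ 2 + e

theorem norm_sq_combination (w z : V) (s t : ℝ) :
    ‖s • w + t • z‖ ^ 2 = s ^ 2 * ‖w‖ ^ 2 + 2 * (s * t) * inner ℝ w z + t ^ 2 * ‖z‖ ^ 2 := by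
  rw [norm_add_sq_real, norm_smul, norm_smul, mul_pow, mul_pow, inner_smul_left, inner_smul_right]
  simp only [Real.norm_eq_abs, sq_abs, conj_trivial]
  ring

theorem StrongConvexOn.le_combination {S : Set V} {g : V → ℝ} {μ : ℝ}
    (hg : StrongConvexOn S μ g) {x z : V} (hx : x ∈ S) (hz : z ∈ S) {t : ℝ} (ht : 0 ≤ t)
    (ht1 : t ≤ 1) :
    g ((1 - t) • x + t • z) ≤
      (1 - t) * g x + t * g z - (1 - t) * t * (μ / 2 * ‖z - x‖ ^ 2) := by
  have := hg.2 hx hz (show 0 ≤ 1 - t by linarith) ht (by ring)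
  rw [norm_sub_rev] at this
  simpa using this

/-- Near-optimality is tested at `(1 - t) • x + t • z`, and the result is divided by `t`. The free
parameter `t` trades the loss in the quadratic term against the inflated error `ε / t`. -/
theorem StrongConvexOn.inexactProx_inequality {S : Set V} {g : V → ℝ} {μ ρ : ℝ}
    (hg : StrongConvexOn S μ g) {y x : V} {ε : ℝ}
    (h : InexactProx S g ρ y x ε) {t : ℝ} (ht : 0 < t) (ht1 : t ≤ 1) {z : V} (hz : z ∈ S) :
    g x + ρ / 2 * ‖x - y‖ ^ 2 + (1 - t) * ((μ + ρ) / 2 * ‖z - x‖ ^ 2) ≤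
      g z + ρ / 2 * ‖z - y‖ ^ 2 + ε / t := by
  have hw : (1 - t) • x + t • z ∈ S :=
    hg.1 h.1 hz (show 0 ≤ 1 - t by linarith) ht.le (by ring)
  have h1 := h.2 _ hw
  have h2 := hg.le_combination h.1 hz ht.le ht1
  have e1 : (1 - t) • x + t • z - y = (1 : ℝ) • (x - y) + t • (z - x) := by module
  have e2 : z - y = (1 : ℝ) • (x - y) + (1 : ℝ) • (z - x) := by module
  rw [e1, norm_sq_combination] at h1
  rw [e2, norm_sq_combination]
  have h3 : t * (g x + ρ / 2 * ‖x - y‖ ^ 2 + (1 - t) * ((μ + ρ) / 2 * ‖z - x‖ ^ 2)) ≤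
      t * (g z + ρ / 2 * (1 ^ 2 * ‖x - y‖ ^ 2 + 2 * (1 * 1) * inner ℝ (x - y) (z - x) +
        1 ^ 2 * ‖z - x‖ ^ 2)) + ε := by
    nlinarith
  have h4 : ε = t * (ε / t) := by field_simp
  rw [h4, ← mul_add] at h3
  exact le_of_mul_le_mul_left h3 ht

theorem StrongConvexOn.approxStep_of_absolute {S : Set V} {g : V → ℝ} {μ ρ : ℝ}
    (hg : StrongConvexOn S μ g) (hρ : 0 ≤ ρ) {y x : V} {ε : ℝ}
    (h : InexactProx S g ρ y x ε) {t : ℝ} (ht : 0 < t) (ht1 : t ≤ 1) :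
    ApproxStep S g μ ρ y x t (ε / t) := by
  refine ⟨h.1, fun z hz => ?_⟩
  have := hg.inexactProx_inequality h ht ht1 hz
  have : 0 ≤ ρ / 2 * ‖x - y‖ ^ 2 := by positivity
  linarith

theorem StrongConvexOn.approxStep_of_relative {S : Set V} {g : V → ℝ} {μ ρ : ℝ}
    (hg : StrongConvexOn S μ g) {y x : V} {t : ℝ}
    (h : InexactProx S g ρ y x (t * (ρ * ‖x - y‖ ^ 2 / 2))) (ht : 0 < t) (ht1 : t ≤ 1) :
    ApproxStep S g μ ρ y x t 0 := by
  refine ⟨h.1, fun z hz => ?_⟩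
  have := hg.inexactProx_inequality h ht ht1 hz
  -- With `t` equal to the relative tolerance, `ε / t` is exactly the term `ρ/2 ‖x - y‖²` on the
  -- left, and the two cancel.
  rw [mul_div_cancel_left₀ _ ht.ne'] at this
  linarith

/-- Comparison with the midpoint; this costs a factor 2 against the sharp constant `μ / 2`, which is
harmless here. -/
theorem StrongConvexOn.sq_norm_le_of_isMinOn {S : Set V} {g : V → ℝ} {μ : ℝ}
    (hg : StrongConvexOn S μ g) {x z : V} (hx : x ∈ S) (hmin : ∀ z ∈ S, g x ≤ g z) (hz : z ∈ S) :
    μ / 4 * ‖z - x‖ ^ 2 ≤ g z - g x := by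
  have h1 := hg.le_combination hx hz (t := 1 / 2) (by norm_num) (by norm_num)
  have h2 := hmin _ (hg.1 hx hz (show (0 : ℝ) ≤ 1 - 1 / 2 by norm_num)
    (show (0 : ℝ) ≤ 1 / 2 by norm_num) (by norm_num))
  linarith

/-- By the recursion `hab`, the vector on the left is a combination of the old Lyapunov vector `u`
and `xs - x`, and a weighted Cauchy–Schwarz inequality splits its square. The last term on the right
is later absorbed by the strong convexity of `g`. -/
theorem extrapolation_sq_norm_le {μ ρ q a b : ℝ} (hρ : 0 < ρ) (hq : q * (μ + ρ) = μ)
    (hq0 : 0 ≤ q) (ha : 0 < a) (hb : 0 < b) (hab : b ^ 2 = (1 - b) * a ^ 2 + q * b)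
    (xs x x' : V) :
    ρ * ‖b • (xs - x) - (a * (1 - a) / (a ^ 2 + b)) • (x - x')‖ ^ 2 ≤
      (1 - b) * (μ + ρ) * ‖a • (xs - x') - (x - x')‖ ^ 2 + μ * b * (1 - b) * ‖xs - x‖ ^ 2 := by
  have hs : 0 < a ^ 2 + b := by positivity
  have e1 : b • (xs - x) - (a * (1 - a) / (a ^ 2 + b)) • (x - x') =
      (a / (a ^ 2 + b)) • (a • (xs - x') - (x - x')) + (q * b / (a ^ 2 + b)) • (xs - x) := by
    have : q * b / (a ^ 2 + b) = b - a ^ 2 / (a ^ 2 + b) := by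
      field_simp
      linarith
    rw [this]
    match_scalars <;> field_simp <;> ring
  set u := a • (xs - x') - (x - x') with hu
  rw [e1]
  have h1 : (a ^ 2 + b) * ((1 - b) * (μ + ρ)) = b * ρ := by
    linear_combination (-(μ + ρ)) * hab - b * hq
  have h2 : ‖(a / (a ^ 2 + b)) • u + (q * b / (a ^ 2 + b)) • (xs - x)‖ ^ 2 ≤
      b / (a ^ 2 + b) * (‖u‖ ^ 2 + q * b * ‖xs - x‖ ^ 2) := by
    have e2 : (a / (a ^ 2 + b)) • u + (q * b / (a ^ 2 + b)) • (xs - x) =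
        (1 / (a ^ 2 + b)) • (a • u + (q * b) • (xs - x)) := by
      match_scalars <;> field_simp
    -- This square is the exact defect in the Cauchy–Schwarz inequality.
    have h3 : 0 ≤ q * b * ‖(1 : ℝ) • u + (-a) • (xs - x)‖ ^ 2 := by positivity
    rw [norm_sq_combination] at h3
    rw [e2, norm_smul, mul_pow, norm_sq_combination, Real.norm_eq_abs, sq_abs, one_div, inv_pow,
      inv_mul_eq_div, div_le_iff₀ (by positivity)]
    have e3 : b / (a ^ 2 + b) * (‖u‖ ^ 2 + q * b * ‖xs - x‖ ^ 2) * (a ^ 2 + b) ^ 2 =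
        b * (a ^ 2 + b) * (‖u‖ ^ 2 + q * b * ‖xs - x‖ ^ 2) := by field_simp
    have e4 : b * (a ^ 2 + b) = a ^ 2 + q * b := by linarith
    rw [e3, e4]
    nlinarith
  calc ρ * ‖(a / (a ^ 2 + b)) • u + (q * b / (a ^ 2 + b)) • (xs - x)‖ ^ 2
      ≤ ρ * (b / (a ^ 2 + b) * (‖u‖ ^ 2 + q * b * ‖xs - x‖ ^ 2)) := by gcongr
    _ = (b * ρ) / (a ^ 2 + b) * (‖u‖ ^ 2 + q * b * ‖xs - x‖ ^ 2) := by ring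
    _ = (1 - b) * (μ + ρ) * (‖u‖ ^ 2 + q * b * ‖xs - x‖ ^ 2) := by
        rw [← h1, mul_div_cancel_left₀ _ hs.ne']
    _ = _ := by linear_combination (1 - b) * b * ‖xs - x‖ ^ 2 * hq

/-- The Lyapunov function of the accelerated proximal point method, after a step from `x'` to `x`
with parameter `a`, relative to the comparison point `xs`. -/
noncomputable def lyapunov (g : V → ℝ) (μ ρ : ℝ) (xs : V) (a : ℝ) (x' x : V) : ℝ :=
  g x - g xs + (μ + ρ) / 2 * ‖a • (xs - x') - (x - x')‖ ^ 2

theorem lyapunov_step {S : Set V} {g : V → ℝ} {μ ρ q a b t e : ℝ} (hg : StrongConvexOn S μ g)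
    (hρ : 0 < ρ) (hq : q * (μ + ρ) = μ) (hq0 : 0 ≤ q) (ha : 0 < a) (hb : 0 < b) (hb1 : b ≤ 1)
    (hab : b ^ 2 = (1 - b) * a ^ 2 + q * b) {xs x' x x₁ : V} (hxs : xs ∈ S)
    (hmin : ∀ z ∈ S, g xs ≤ g z) (hx : x ∈ S) (ht : 0 ≤ t)
    (h : ApproxStep S g μ ρ (x + (a * (1 - a) / (a ^ 2 + b)) • (x - x')) x₁ t e) :
    (1 - t) * lyapunov g μ ρ xs b x x₁ ≤ (1 - b) * lyapunov g μ ρ xs a x' x + e := by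
  -- At this test point, `z - x₁` is the new Lyapunov vector and `z - y` is the vector bounded by
  -- `extrapolation_sq_norm_le`.
  have hz : (1 - b) • x + b • xs ∈ S :=
    hg.1 hx hxs (show 0 ≤ 1 - b by linarith) hb.le (by ring)
  have h1 := h.2 _ hz
  have h2 := hg.le_combination hx hxs hb.le hb1
  have h3 := extrapolation_sq_norm_le hρ hq hq0 ha hb hab xs x x'
  have e1 : (1 - b) • x + b • xs - x₁ = b • (xs - x) - (x₁ - x) := by module
  have e2 : (1 - b) • x + b • xs - (x + (a * (1 - a) / (a ^ 2 + b)) • (x - x')) =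
      b • (xs - x) - (a * (1 - a) / (a ^ 2 + b)) • (x - x') := by module
  rw [e1, e2] at h1
  -- The factor `1 - t` sits on the quadratic term only; nonnegativity of the gap lets it multiply
  -- the whole Lyapunov function.
  have h4 := mul_nonneg ht (sub_nonneg.2 (hmin _ h.1))
  unfold lyapunov
  linarith

/-- The first step has no extrapolation and is tested at `xs`. The bound involves `x` only through
its distance to `xs`, so `x` may lie outside the domain. -/
theorem lyapunov_first_le {S : Set V} {g : V → ℝ} {μ ρ a t e : ℝ} (hμρ : 0 ≤ μ + ρ) {xs x x₁ : V}
    (hxs : xs ∈ S) (hmin : ∀ z ∈ S, g xs ≤ g z) (ht : 0 ≤ t) (ht1 : t < 1)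
    (h : ApproxStep S g μ ρ x x₁ t e) :
    lyapunov g μ ρ xs a x x₁ ≤ 2 * (ρ / 2 * ‖xs - x‖ ^ 2 + e) / (1 - t) +
      (μ + ρ) * (1 - a) ^ 2 * ‖xs - x‖ ^ 2 := by
  have h1 := h.2 _ hxs
  have h2 := hmin _ h.1
  have e1 : a • (xs - x) - (x₁ - x) = (1 : ℝ) • (xs - x₁) + (a - 1) • (xs - x) := by module
  have h3 : ‖a • (xs - x) - (x₁ - x)‖ ^ 2 ≤ 2 * ‖xs - x₁‖ ^ 2 + 2 * (1 - a) ^ 2 * ‖xs - x‖ ^ 2 := by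
    have : 0 ≤ ‖(1 : ℝ) • (xs - x₁) + (-(a - 1)) • (xs - x)‖ ^ 2 := by positivity
    rw [norm_sq_combination] at this
    rw [e1, norm_sq_combination]
    nlinarith
  have h4 : g x₁ - g xs + (μ + ρ) * ‖xs - x₁‖ ^ 2 ≤
      2 * (ρ / 2 * ‖xs - x‖ ^ 2 + e) / (1 - t) := by
    rw [le_div_iff₀ (by linarith)]
    nlinarith [mul_nonneg ht (sub_nonneg.2 h2)]
  have h5 := mul_le_mul_of_nonneg_left h3 (show 0 ≤ (μ + ρ) / 2 by linarith)
  unfold lyapunov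
  linarith

end InexactProximalStep

/-! ### The Catalyst sequence and the potential along an execution. -/

namespace CatalystSpy

variable {d M : ℕ} (D : CatalystSpy d M)

/-- The domain of `F`. -/
def dom : Set (Vec d) := {x | D.r x ≠ ⊤}

/-- The real value of `F` on its domain. -/
noncomputable def realF (x : Vec d) : ℝ := ∑ i, D.a i * D.f i x + (D.r x).toReal

/-- The Lyapunov function at the end of the outer loop `k + 1`. -/
noncomputable def potential (xs : Vec d) (w : Execution d M) (k : ℕ) : ℝ :=
  lyapunov D.realF D.μ D.ρ xs (D.alpha k) (D.X w (k + 1)) (D.X w (k + 2))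

variable {D}

theorem q_mul (hμρ : 0 < D.μ + D.ρ) : D.q * (D.μ + D.ρ) = D.μ :=
  div_mul_cancel₀ _ hμρ.ne'

theorem q_nonneg (hμ : 0 ≤ D.μ) (hρ : 0 < D.ρ) : 0 ≤ D.q := by
  unfold q; positivity

theorem q_lt_one (hμ : 0 ≤ D.μ) (hρ : 0 < D.ρ) : D.q < 1 := by
  unfold q; rw [div_lt_one (by positivity)]; linarith

theorem alpha_succ_sq (k : ℕ) :
    D.alpha (k + 1) ^ 2 = (1 - D.alpha (k + 1)) * D.alpha k ^ 2 + D.q * D.alpha (k + 1) := by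
  have h := Real.sq_sqrt (show 0 ≤ (D.q - D.alpha k ^ 2) ^ 2 + 4 * D.alpha k ^ 2 by positivity)
  rw [alpha]
  linear_combination h / 4

theorem alpha_pos (hρ : 0 < D.ρ) (k : ℕ) : 0 < D.alpha k := by
  induction k with
  | zero =>
    rw [alpha]
    split_ifs with h
    · exact Real.sqrt_pos.2 (div_pos h (by linarith))
    · exact one_pos
  | succ k ih =>
    rw [alpha]
    have h : |D.q - D.alpha k ^ 2| < √((D.q - D.alpha k ^ 2) ^ 2 + 4 * D.alpha k ^ 2) := by
      rw [← Real.sqrt_sq_eq_abs]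
      exact Real.sqrt_lt_sqrt (sq_nonneg _) (by nlinarith [pow_pos ih 2])
    have := neg_abs_le (D.q - D.alpha k ^ 2)
    linarith

theorem alpha_le_one (hμ : 0 ≤ D.μ) (hρ : 0 < D.ρ) (k : ℕ) : D.alpha k ≤ 1 := by
  have hq := q_lt_one hμ hρ
  cases k with
  | zero =>
    rw [alpha]
    split_ifs with h
    · exact Real.sqrt_le_one.2 hq.le
    · exact le_rfl
  | succ k =>
    by_contra! h
    have h1 := D.alpha_succ_sq k
    have h2 := mul_nonneg (sub_nonneg.2 h.le) (sq_nonneg (D.alpha k))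
    nlinarith

theorem alpha_eq_sqrt (hμ : 0 < D.μ) (hρ : 0 < D.ρ) (k : ℕ) : D.alpha k = √D.q := by
  induction k with
  | zero => rw [alpha, if_pos hμ]
  | succ k ih =>
    have h := Real.sq_sqrt (q_nonneg hμ.le hρ)
    rw [alpha, ih, h, sub_self, show (0 : ℝ) ^ 2 + 4 * D.q = (2 * √D.q) ^ 2 by
      rw [mul_pow, h]; ring, Real.sqrt_sq (by positivity)]
    ring

/-- For `q = 0` the inverses satisfy `A'(A' - 1) = A²`, so each step increases them by at least
`1/2` and at most `1`. The lower bound yields the rate, the upper one controls the errors. -/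
theorem inv_alpha_bounds (hμ : D.μ = 0) (hρ : 0 < D.ρ) (k : ℕ) :
    (k + 2) / 2 ≤ (D.alpha k)⁻¹ ∧ (D.alpha k)⁻¹ ≤ k + 1 := by
  induction k with
  | zero => simp [alpha, hμ]
  | succ k ih =>
    have ha := alpha_pos hρ k
    have hb := alpha_pos hρ (k + 1)
    have h := D.alpha_succ_sq k
    rw [show D.q = 0 by simp [q, hμ]] at h
    set a := D.alpha k
    set b := D.alpha (k + 1)
    have h1 : a⁻¹ ^ 2 = b⁻¹ * (b⁻¹ - 1) := by
      field_simp
      linarith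
    have ha' := inv_pos.2 ha
    have hb' : 0 < b⁻¹ := inv_pos.2 hb
    have h2 : 1 < b⁻¹ := by
      by_contra! h3
      nlinarith [pow_pos ha' 2]
    push_cast
    constructor
    · by_contra! h3
      have : b⁻¹ < a⁻¹ + 1 / 2 := by linarith
      nlinarith
    · by_contra! h3
      have : a⁻¹ + 1 < b⁻¹ := by linarith
      nlinarith

theorem X_eq_innerOutput (w : Execution d M) (m : ℕ) :
    D.X w (m + 2) = D.innerOutput w (m + 1) (D.Y w (m + 1)) := rfl

theorem Produces.stopTest {w : Execution d M} {n : ℕ} (h : D.Produces w n) {m : ℕ} (hm : m < n) :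
    D.StopTest (m + 1) (D.Y w (m + 1)) (D.X w (m + 2)) := by
  rw [X_eq_innerOutput]
  -- `Produces` makes the set of stopping times nonempty; otherwise `sInf` would be `0` and the
  -- output untested.
  exact Nat.sInf_mem (s := {k | D.StopTest (m + 1) (D.Y w (m + 1))
    (D.innerPoint w (m + 1) (D.Y w (m + 1)) k)}) (h (m + 1) (by omega) (by omega))

theorem potential_step {xs : Vec d} (hμ : 0 ≤ D.μ) (hρ : 0 < D.ρ)
    (hg : StrongConvexOn D.dom D.μ D.realF) (hxs : xs ∈ D.dom)
    (hmin : ∀ z ∈ D.dom, D.realF xs ≤ D.realF z)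
    {w : Execution d M} {k : ℕ} (hX : D.X w (k + 2) ∈ D.dom) {t e : ℝ}
    (ht : 0 ≤ t)
    (h : ApproxStep D.dom D.realF D.μ D.ρ (D.Y w (k + 2)) (D.X w (k + 3)) t e) :
    (1 - t) * D.potential xs w (k + 1) ≤ (1 - D.alpha (k + 1)) * D.potential xs w k + e :=
  -- `Y w (k + 2)` unfolds definitionally to the extrapolated point, with `beta (k + 1)` built from
  -- `alpha k` and `alpha (k + 1)`.
  lyapunov_step hg hρ (q_mul (by linarith)) (q_nonneg hμ hρ) (alpha_pos hρ k)
    (alpha_pos hρ (k + 1)) (alpha_le_one hμ hρ (k + 1)) (D.alpha_succ_sq k) hxs hmin hX ht h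

theorem potential_le_geometric {xs : Vec d} (hμ : 0 ≤ D.μ) (hρ : 0 < D.ρ)
    (hg : StrongConvexOn D.dom D.μ D.realF) (hxs : xs ∈ D.dom)
    (hmin : ∀ z ∈ D.dom, D.realF xs ≤ D.realF z)
    (hμ' : 0 < D.μ) {w : Execution d M} {n : ℕ} {t s r c B : ℝ}
    (ht : 0 ≤ t) (ht1 : t < 1) (hs : 0 ≤ s) (hr : 0 ≤ r) (hts : (1 - t) * s = 1 - √D.q)
    (hB : c * r ≤ B * (r - s)) (h0 : D.potential xs w 0 ≤ B)
    (h : ∀ k ≤ n, ApproxStep D.dom D.realF D.μ D.ρ (D.Y w (k + 1)) (D.X w (k + 2)) t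
      ((1 - t) * (c * r ^ k))) :
    D.potential xs w n ≤ B * r ^ n := by
  refine le_mul_geometric_of_contraction hs hr h0 hB (fun k hk => ?_) n le_rfl
  have h1 := potential_step hμ hρ hg hxs hmin (h k hk.le).1 ht (h (k + 1) hk)
  rw [alpha_eq_sqrt hμ' hρ, ← hts, mul_assoc, ← mul_add] at h1
  exact le_of_mul_le_mul_left h1 (by linarith)

theorem potential_le_div_sq {xs : Vec d} (hμ : 0 ≤ D.μ) (hρ : 0 < D.ρ)
    (hg : StrongConvexOn D.dom D.μ D.realF) (hxs : xs ∈ D.dom)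
    (hmin : ∀ z ∈ D.dom, D.realF xs ≤ D.realF z)
    (hμ' : D.μ = 0) {w : Execution d M} {n : ℕ} {t e : ℕ → ℝ}
    {B St Se : ℝ} (hB : 0 ≤ B) (h0 : D.potential xs w 0 ≤ B)
    (ht : ∀ k, 0 ≤ t k) (ht' : ∀ k, t k ≤ 1 / 2) (he : ∀ k, 0 ≤ e k)
    (hSt : ∀ k, ∑ j ∈ Finset.range k, t j ≤ St) (hSe : ∀ k, ∑ j ∈ Finset.range k, e j ≤ Se)
    (hX : ∀ k < n, D.X w (k + 2) ∈ D.dom)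
    (h : ∀ k < n, ApproxStep D.dom D.realF D.μ D.ρ (D.Y w (k + 2)) (D.X w (k + 3)) (t k)
      (e k / ((k : ℝ) + 2) ^ 2)) :
    D.potential xs w n ≤ 4 * (Real.exp (2 * St) * (B + Se)) / ((n : ℝ) + 1) ^ 2 := by
  have hpos := alpha_pos hρ
  -- Since `q = 0`, the normalization by `alpha k ^ 2` turns the factor `1 - alpha (k + 1)` into
  -- `1`.
  have key := le_of_perturbed_contraction (u := fun k => D.potential xs w k / D.alpha k ^ 2)
    hB (by simpa [alpha, hμ'] using h0) ht ht' he hSt hSe (n := n) (fun k hk => ?_) n le_rfl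
  · have hSe0 : 0 ≤ Se := by simpa using hSe 0
    have hn := (inv_alpha_bounds hμ' hρ n).1
    have h1 : D.alpha n ≤ 2 / ((n : ℝ) + 1) := by
      rw [le_div_iff₀ (by positivity)]
      have := mul_le_mul_of_nonneg_right hn (hpos n).le
      rw [inv_mul_cancel₀ (hpos n).ne'] at this
      nlinarith [hpos n]
    rw [div_le_iff₀ (pow_pos (hpos n) 2)] at key
    calc D.potential xs w n ≤ Real.exp (2 * St) * (B + Se) * D.alpha n ^ 2 := key
      _ ≤ Real.exp (2 * St) * (B + Se) * (2 / ((n : ℝ) + 1)) ^ 2 := by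
        have := (hpos n).le
        gcongr
      _ = _ := by rw [div_pow]; ring
  · have h1 := potential_step hμ hρ hg hxs hmin (hX k hk) (ht k) (h k hk)
    have h2 := D.alpha_succ_sq k
    rw [show D.q = 0 by simp [q, hμ'], zero_mul, add_zero] at h2
    have h3 := (inv_alpha_bounds hμ' hρ (k + 1)).2
    have ha := hpos k
    have hb := hpos (k + 1)
    push_cast at h3
    have h4 : e k / ((k : ℝ) + 2) ^ 2 ≤ e k * D.alpha (k + 1) ^ 2 := by
      rw [div_le_iff₀ (by positivity), mul_assoc, ← mul_pow]
      refine le_mul_of_one_le_right (he k) (one_le_pow₀ ?_)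
      rw [inv_le_iff_one_le_mul₀ hb] at h3
      nlinarith
    have h5 : (1 - D.alpha (k + 1)) * D.potential xs w k =
        D.alpha (k + 1) ^ 2 * (D.potential xs w k / D.alpha k ^ 2) := by
      rw [h2]; field_simp
    rw [mul_div_assoc', div_le_iff₀ (by positivity)]
    linarith

theorem potential_zero_le {xs : Vec d} (hμ : 0 ≤ D.μ) (hρ : 0 < D.ρ) (hxs : xs ∈ D.dom)
    (hmin : ∀ z ∈ D.dom, D.realF xs ≤ D.realF z)
    {w : Execution d M} {t e : ℝ} (ht : 0 ≤ t) (ht1 : t < 1)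
    (h : ApproxStep D.dom D.realF D.μ D.ρ (D.Y w 1) (D.X w 2) t e) :
    D.potential xs w 0 ≤ 2 * (D.ρ / 2 * ‖xs - D.x₁‖ ^ 2 + e) / (1 - t) +
      (D.μ + D.ρ) * (1 - D.alpha 0) ^ 2 * ‖xs - D.x₁‖ ^ 2 :=
  lyapunov_first_le (by linarith) hxs hmin ht ht1 h

theorem realF_sub_le_potential (hμρ : 0 ≤ D.μ + D.ρ) (xs : Vec d) (w : Execution d M) (k : ℕ) :
    D.realF (D.X w (k + 2)) - D.realF xs ≤ D.potential xs w k := by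
  unfold potential lyapunov
  have : 0 ≤ (D.μ + D.ρ) / 2 *
      ‖D.alpha k • (xs - D.X w (k + 1)) - (D.X w (k + 1 + 1) - D.X w (k + 1))‖ ^ 2 := by positivity
  linarith

/-! ### From extended values to real values, and existence of a minimizer. -/

theorem F_eq_coe (hr_bot : ∀ x, D.r x ≠ ⊥) {x : Vec d} (hx : x ∈ D.dom) :
    D.F x = (D.realF x : EReal) := by
  unfold F objective realF
  rw [EReal.coe_add, EReal.coe_toReal hx (hr_bot x)]

theorem F_eq_top {x : Vec d} (hx : x ∉ D.dom) : D.F x = ⊤ := by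
  unfold F objective
  rw [show D.r x = ⊤ by simpa [dom] using hx, EReal.coe_add_top]

theorem H_eq_add (ha_sum : ∑ i, D.a i = 1) (y x : Vec d) :
    D.H y x = D.F x + ((D.ρ / 2 * ‖x - y‖ ^ 2 : ℝ) : EReal) := by
  unfold H F objective regularized
  simp only [mul_add, Finset.sum_add_distrib]
  rw [← Finset.sum_mul, ha_sum, one_mul, EReal.coe_add, add_right_comm]

theorem H_eq_coe (hr_bot : ∀ x, D.r x ≠ ⊥) (ha_sum : ∑ i, D.a i = 1) (y : Vec d) {x : Vec d}
    (hx : x ∈ D.dom) :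
    D.H y x = ((D.realF x + D.ρ / 2 * ‖x - y‖ ^ 2 : ℝ) : EReal) := by
  rw [H_eq_add ha_sum, F_eq_coe hr_bot hx, EReal.coe_add]

theorem inexactProx_of_sub_iInf_le (hr_bot : ∀ x, D.r x ≠ ⊥) (hr_proper : ∃ x, D.r x ≠ ⊤)
    (ha_sum : ∑ i, D.a i = 1) {y x : Vec d} {e : ℝ} (h : D.H y x - ⨅ z, D.H y z ≤ (e : EReal)) :
    InexactProx D.dom D.realF D.ρ y x e := by
  rw [EReal.sub_le_iff_le_add (Or.inr (EReal.coe_ne_top _)) (Or.inr (EReal.coe_ne_bot _))] at h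
  have key : ∀ z ∈ D.dom,
      D.H y x ≤ ((e + (D.realF z + D.ρ / 2 * ‖z - y‖ ^ 2) : ℝ) : EReal) := by
    intro z hz
    rw [EReal.coe_add, ← H_eq_coe hr_bot ha_sum y hz]
    exact h.trans (add_le_add le_rfl (iInf_le _ z))
  -- One comparison point of finite value suffices: outside the domain the left side would be `⊤`.
  have hx : x ∈ D.dom := by
    obtain ⟨z, hz⟩ := hr_proper
    by_contra hx
    have := key z hz
    rw [H_eq_add ha_sum, F_eq_top hx, EReal.top_add_coe, top_le_iff] at this
    exact EReal.coe_ne_top _ this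
  refine ⟨hx, fun z hz => ?_⟩
  have := key z hz
  rw [H_eq_coe hr_bot ha_sum y hx, EReal.coe_le_coe_iff] at this
  linarith

theorem convexOn_toReal (hr_bot : ∀ x, D.r x ≠ ⊥) (hr_conv : EpiConvex D.r) :
    ConvexOn ℝ D.dom fun x => (D.r x).toReal := by
  have key : ∀ x ∈ D.dom, ∀ z ∈ D.dom, ∀ a b : ℝ, 0 ≤ a → 0 ≤ b → a + b = 1 →
      D.r (a • x + b • z) ≤ ((a * (D.r x).toReal + b * (D.r z).toReal : ℝ) : EReal) := by
    intro x hx z hz a b ha hb hab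
    have := hr_conv (x := (x, (D.r x).toReal)) (y := (z, (D.r z).toReal))
      (by simp [EReal.coe_toReal hx (hr_bot x)]) (by simp [EReal.coe_toReal hz (hr_bot z)])
      ha hb hab
    simpa using this
  have hdom : ∀ x ∈ D.dom, ∀ z ∈ D.dom, ∀ a b : ℝ, 0 ≤ a → 0 ≤ b → a + b = 1 →
      a • x + b • z ∈ D.dom := fun x hx z hz a b ha hb hab =>
    ((key x hx z hz a b ha hb hab).trans_lt (EReal.coe_lt_top _)).ne
  refine ⟨fun x hx z hz a b ha hb hab => hdom x hx z hz a b ha hb hab,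
    fun x hx z hz a b ha hb hab => ?_⟩
  have := key x hx z hz a b ha hb hab
  rw [← EReal.coe_toReal (hdom x hx z hz a b ha hb hab) (hr_bot _),
    EReal.coe_le_coe_iff] at this
  simpa using this

theorem strongConvexOn_realF (ha : ∀ i, 0 ≤ D.a i) (ha_sum : ∑ i, D.a i = 1)
    (hf_conv : ∀ i, StrongConvexOn Set.univ D.μ (D.f i)) (hr_bot : ∀ x, D.r x ≠ ⊥)
    (hr_conv : EpiConvex D.r) : StrongConvexOn D.dom D.μ D.realF := by
  have hr := convexOn_toReal hr_bot hr_conv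
  refine ⟨hr.1, fun x hx z hz a b h0a h0b hab => ?_⟩
  have h1 := hr.2 hx hz h0a h0b hab
  have h2 : ∑ i, D.a i * D.f i (a • x + b • z) ≤
      ∑ i, D.a i * (a • D.f i x + b • D.f i z - a * b * (D.μ / 2 * ‖x - z‖ ^ 2)) :=
    Finset.sum_le_sum fun i _ => mul_le_mul_of_nonneg_left
      ((hf_conv i).2 (Set.mem_univ x) (Set.mem_univ z) h0a h0b hab) (ha i)
  have h3 : ∑ i, D.a i * (a • D.f i x + b • D.f i z - a * b * (D.μ / 2 * ‖x - z‖ ^ 2)) =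
      a * ∑ i, D.a i * D.f i x + b * ∑ i, D.a i * D.f i z -
        a * b * (D.μ / 2 * ‖x - z‖ ^ 2) := by
    calc _ = ∑ i, (a * (D.a i * D.f i x) + b * (D.a i * D.f i z) -
          D.a i * (a * b * (D.μ / 2 * ‖x - z‖ ^ 2))) :=
        Finset.sum_congr rfl fun i _ => by simp only [smul_eq_mul]; ring
      _ = _ := by
        rw [Finset.sum_sub_distrib, Finset.sum_add_distrib, ← Finset.mul_sum, ← Finset.mul_sum,
          ← Finset.sum_mul, ha_sum, one_mul]
  simp only [smul_eq_mul] at h1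
  simp only [realF, smul_eq_mul]
  linarith

theorem lowerSemicontinuous_F (hf : ∀ i, Continuous (D.f i)) (hr_lsc : LowerSemicontinuous D.r) :
    LowerSemicontinuous D.F := by
  have hc : Continuous fun x => ((∑ i, D.a i * D.f i x : ℝ) : EReal) :=
    continuous_coe_real_ereal.comp
      (continuous_finsetSum _ fun i _ => continuous_const.mul (hf i))
  exact hc.lowerSemicontinuous.add' hr_lsc fun x =>
    EReal.continuousAt_add (Or.inl (EReal.coe_ne_top _)) (Or.inl (EReal.coe_ne_bot _))

theorem isMinimizer_iff (hr_bot : ∀ x, D.r x ≠ ⊥) (hr_proper : ∃ x, D.r x ≠ ⊤) {x : Vec d} :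
    IsMinimizer D.F x ↔ x ∈ D.dom ∧ ∀ z ∈ D.dom, D.realF x ≤ D.realF z := by
  constructor
  · intro h
    have hx : x ∈ D.dom := by
      obtain ⟨z, hz⟩ := hr_proper
      by_contra hx
      have := h z
      rw [F_eq_top hx, F_eq_coe hr_bot hz, top_le_iff] at this
      exact EReal.coe_ne_top _ this
    refine ⟨hx, fun z hz => ?_⟩
    have := h z
    rwa [F_eq_coe hr_bot hx, F_eq_coe hr_bot hz, EReal.coe_le_coe_iff] at this
  · rintro ⟨hx, h⟩ z
    by_cases hz : z ∈ D.dom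
    · rw [F_eq_coe hr_bot hx, F_eq_coe hr_bot hz, EReal.coe_le_coe_iff]
      exact h z hz
    · rw [F_eq_top hz]
      exact le_top

theorem iInf_F_eq {x : Vec d} (h : IsMinimizer D.F x) : ⨅ z, D.F z = D.F x :=
  le_antisymm (iInf_le _ x) (le_iInf h)

/-- Compactness gives a minimizer on a ball. Outside a large ball, strong convexity along the
segment from `x₀` to `z`, together with a lower bound on the unit ball, forces the value at `z` to
be at least that at `x₀`. -/
theorem exists_isMinimizer_F (hμ : 0 < D.μ) (hr_bot : ∀ x, D.r x ≠ ⊥)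
    (hr_proper : ∃ x, D.r x ≠ ⊤) (hg : StrongConvexOn D.dom D.μ D.realF)
    (hF : LowerSemicontinuous D.F) : ∃ x, IsMinimizer D.F x := by
  obtain ⟨x₀, hx₀⟩ := hr_proper
  have hmin : ∀ R : ℝ, 0 ≤ R → ∃ m ∈ Metric.closedBall x₀ R, m ∈ D.dom ∧
      ∀ z ∈ Metric.closedBall x₀ R, z ∈ D.dom → D.realF m ≤ D.realF z := by
    intro R hR
    obtain ⟨m, hm, hmin⟩ := LowerSemicontinuousOn.exists_isMinOn
      ⟨x₀, Metric.mem_closedBall_self hR⟩ (isCompact_closedBall x₀ R) (hF.lowerSemicontinuousOn _)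
    have hmd : m ∈ D.dom := by
      by_contra h
      have : D.F m ≤ D.F x₀ := hmin (Metric.mem_closedBall_self hR)
      rw [F_eq_top h, F_eq_coe hr_bot hx₀, top_le_iff] at this
      exact EReal.coe_ne_top _ this
    refine ⟨m, hm, hmd, fun z hz hzd => ?_⟩
    have : D.F m ≤ D.F z := hmin hz
    rwa [F_eq_coe hr_bot hmd, F_eq_coe hr_bot hzd, EReal.coe_le_coe_iff] at this
  obtain ⟨b, -, -, hb⟩ := hmin 1 zero_le_one
  -- Beyond this radius the strong convexity gain `μ/2 (R - 1)` exceeds the possible decrease `F x₀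
  -- - F b` on the unit ball.
  set R₀ : ℝ := 1 + max 0 (2 / D.μ * (D.realF x₀ - D.realF b)) with hR₀
  have h0 : 1 ≤ R₀ := by
    have := le_max_left 0 (2 / D.μ * (D.realF x₀ - D.realF b))
    linarith
  obtain ⟨m, -, hmd, hm⟩ := hmin R₀ (by linarith)
  refine ⟨m, (isMinimizer_iff hr_bot ⟨x₀, hx₀⟩).2 ⟨hmd, fun z hz => ?_⟩⟩
  by_cases hzR : z ∈ Metric.closedBall x₀ R₀
  · exact hm z hzR hz
  refine (hm x₀ (Metric.mem_closedBall_self (by linarith)) hx₀).trans ?_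
  rw [Metric.mem_closedBall, dist_eq_norm, not_le] at hzR
  set R := ‖z - x₀‖
  have hR : 0 < R := by linarith
  have ht1 : 1 / R ≤ 1 := by rw [div_le_one hR]; linarith
  have h1 := hg.le_combination hx₀ hz (t := 1 / R) (by positivity) ht1
  have h2 := hb ((1 - 1 / R) • x₀ + (1 / R) • z) (by
      rw [Metric.mem_closedBall, dist_eq_norm,
        show (1 - 1 / R) • x₀ + (1 / R) • z - x₀ = (1 / R) • (z - x₀) by module, norm_smul,
        Real.norm_of_nonneg (by positivity)]
      exact (one_div_mul_cancel hR.ne').le)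
    (hg.1 hx₀ hz (show 0 ≤ 1 - 1 / R by linarith) (show 0 ≤ 1 / R by positivity) (by ring))
  have h3 : D.realF x₀ - D.realF b ≤ D.μ / 2 * (R - 1) := by
    have h4 := le_max_right 0 (2 / D.μ * (D.realF x₀ - D.realF b))
    have h5 : 2 / D.μ * (D.realF x₀ - D.realF b) ≤ R - 1 := by linarith
    calc D.realF x₀ - D.realF b = D.μ / 2 * (2 / D.μ * (D.realF x₀ - D.realF b)) := by
          field_simp
      _ ≤ _ := by gcongr
  have h6 : (1 - 1 / R) * (1 / R) * (D.μ / 2 * R ^ 2) = D.μ / 2 * (R - 1) := by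
    field_simp
  have h7 : 1 / R * (D.realF z - D.realF x₀) ≥ 0 := by linarith [h2.trans h1]
  have := (mul_nonneg_iff_of_pos_left (show 0 < 1 / R by positivity)).1 h7
  linarith

/-! ### Rates of the potential under each stopping criterion. -/

theorem Produces.inexactProx_absolute (hr_bot : ∀ x, D.r x ≠ ⊥) (hr_proper : ∃ x, D.r x ≠ ⊤)
    (ha_sum : ∑ i, D.a i = 1) (hrule : D.rule = StoppingRule.absolute) (hx₁ : D.x₁ ∈ D.dom)
    {xs : Vec d} (hxs : IsMinimizer D.F xs) {w : Execution d M} {n : ℕ} (h : D.Produces w n)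
    {m : ℕ} (hm : m < n) :
    InexactProx D.dom D.realF D.ρ (D.Y w (m + 1)) (D.X w (m + 2))
      (D.absFactor (m + 1) * (2 / 9) * (D.realF D.x₁ - D.realF xs)) := by
  have hs := h.stopTest hm
  unfold StopTest at hs
  rw [hrule] at hs
  refine inexactProx_of_sub_iInf_le hr_bot hr_proper ha_sum (hs.trans_eq ?_)
  rw [iInf_F_eq hxs, F_eq_coe hr_bot hx₁,
    F_eq_coe hr_bot ((isMinimizer_iff hr_bot hr_proper).1 hxs).1, ← EReal.coe_sub,
    ← EReal.coe_mul]

theorem Produces.inexactProx_relative (hr_bot : ∀ x, D.r x ≠ ⊥) (hr_proper : ∃ x, D.r x ≠ ⊤)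
    (ha_sum : ∑ i, D.a i = 1) (hrule : D.rule = StoppingRule.relative)
    {w : Execution d M} {n : ℕ} (h : D.Produces w n) {m : ℕ} (hm : m < n) :
    InexactProx D.dom D.realF D.ρ (D.Y w (m + 1)) (D.X w (m + 2))
      (D.relFactor (m + 1) * (D.ρ * ‖D.X w (m + 2) - D.Y w (m + 1)‖ ^ 2 / 2)) := by
  have hs := h.stopTest hm
  unfold StopTest at hs
  rw [hrule] at hs
  exact inexactProx_of_sub_iInf_le hr_bot hr_proper ha_sum hs

theorem sqrt_q_div_two :
    √(D.μ / (4 * (D.μ + D.ρ))) = √D.q / 2 := by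
  rw [show D.μ / (4 * (D.μ + D.ρ)) = D.q / 2 ^ 2 by unfold q; rw [div_div]; ring_nf,
    Real.sqrt_div' _ (by norm_num), Real.sqrt_sq (by norm_num)]

theorem relFactor_eq (hμ : 0 < D.μ) (hρ : 0 < D.ρ) (m : ℕ) :
    D.relFactor m = √D.q / (2 - √D.q) := by
  have hw : 0 < √(D.μ + D.ρ) := Real.sqrt_pos.2 (by linarith)
  rw [relFactor, if_pos hμ, q, Real.sqrt_div hμ.le,
    show 2 - √D.μ / √(D.μ + D.ρ) = (2 * √(D.μ + D.ρ) - √D.μ) / √(D.μ + D.ρ) by field_simp,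
    div_div_div_cancel_right₀ hw.ne']

theorem exists_potential_le_geometric (hμ : 0 < D.μ) (hρ : 0 < D.ρ)
    (hr_bot : ∀ x, D.r x ≠ ⊥) (hr_proper : ∃ x, D.r x ≠ ⊤) (ha_sum : ∑ i, D.a i = 1)
    (hg : StrongConvexOn D.dom D.μ D.realF) (hx₁ : D.rule = StoppingRule.absolute → D.x₁ ∈ D.dom)
    {xs : Vec d} (hxs : IsMinimizer D.F xs) :
    ∃ B, 0 ≤ B ∧ ∀ w n, D.Produces w (n + 1) →
      D.potential xs w n ≤ B * (1 - √D.q / 2) ^ n := by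
  obtain ⟨hxd, hmin⟩ := (isMinimizer_iff hr_bot hr_proper).1 hxs
  have hx0 : 0 < √D.q := by
    have := alpha_pos hρ 0; rwa [alpha_eq_sqrt hμ hρ] at this
  have hx1 : √D.q < 1 := by
    rw [Real.sqrt_lt' one_pos, one_pow]; exact q_lt_one hμ.le hρ
  obtain ⟨t, s, c, B, ht, ht1, hs, hts, hB, hstep⟩ : ∃ t s c B : ℝ, 0 ≤ t ∧ t < 1 ∧ 0 ≤ s ∧
      (1 - t) * s = 1 - √D.q ∧
      (∀ B', B ≤ B' → c * (1 - √D.q / 2) ≤ B' * ((1 - √D.q / 2) - s)) ∧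
      ∀ w n, D.Produces w (n + 1) → ∀ k ≤ n,
        ApproxStep D.dom D.realF D.μ D.ρ (D.Y w (k + 1)) (D.X w (k + 2)) t
          ((1 - t) * (c * (1 - √D.q / 2) ^ k)) := by
    cases hrule : D.rule with
    | absolute =>
      set x := √D.q
      set K := 2 / 9 * (D.realF D.x₁ - D.realF xs)
      have hs : 0 < 1 - 3 / 4 * x := by linarith
      have ht : 0 < 1 - (1 - x) / (1 - 3 / 4 * x) := by
        rw [sub_pos, div_lt_one hs]; linarith
      have ht1 : 0 < (1 - x) / (1 - 3 / 4 * x) := div_pos (by linarith) hs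
      -- This makes the contraction factor `1 - 3x/4`, strictly below the rate `1 - x/2` at which
      -- the tolerances decay; the gap `x/4` pays for the errors.
      set t := 1 - (1 - x) / (1 - 3 / 4 * x)
      have ht1' : 0 < 1 - t := by rwa [sub_sub_cancel]
      set c := (1 - x / 2) * K / (t * (1 - t))
      refine ⟨t, 1 - 3 / 4 * x, c, c * (1 - x / 2) / (x / 4), ht.le, by linarith, hs.le, ?_,
        fun B' hB' => ?_, fun w n hw k hk => ?_⟩
      · rw [sub_sub_cancel, div_mul_cancel₀ _ hs.ne']
      · rw [div_le_iff₀ (by positivity)] at hB'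
        linarith
      · have h1 := hg.approxStep_of_absolute hρ.le (hw.inexactProx_absolute hr_bot hr_proper
          ha_sum hrule (hx₁ hrule) hxs (show k < n + 1 by omega)) ht (by linarith)
        rw [absFactor, if_pos hμ, sqrt_q_div_two] at h1
        convert h1 using 1
        simp only [c, K]
        field_simp
        ring
    | relative =>
      -- With `t` the relative tolerance, `(1 - √q) / (1 - t)` is exactly `1 - √q / 2`, and no
      -- absolute error remains.
      refine ⟨√D.q / (2 - √D.q), 1 - √D.q / 2, 0, 0, div_nonneg hx0.le (by linarith), ?_,
        by linarith, ?_, by simp, fun w n hw k hk => ?_⟩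
      · rw [div_lt_one (by linarith)]; linarith
      · have : 2 - √D.q ≠ 0 := by linarith
        field_simp
        ring
      · have h1 := hw.inexactProx_relative hr_bot hr_proper ha_sum hrule
          (show k < n + 1 by omega)
        rw [relFactor_eq hμ hρ] at h1
        simpa using hg.approxStep_of_relative h1 (div_pos hx0 (by linarith))
          (by rw [div_le_one (by linarith)]; linarith)
  refine ⟨max 0 (max B (2 * (D.ρ / 2 * ‖xs - D.x₁‖ ^ 2 +
    (1 - t) * (c * (1 - √D.q / 2) ^ 0)) / (1 - t) +
    (D.μ + D.ρ) * (1 - D.alpha 0) ^ 2 * ‖xs - D.x₁‖ ^ 2)), le_max_left _ _, fun w n hw => ?_⟩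
  refine potential_le_geometric hμ.le hρ hg hxd hmin hμ ht ht1 hs (by linarith) hts
    (hB _ ((le_max_left _ _).trans (le_max_right _ _))) ?_ (hstep w n hw)
  exact (potential_zero_le hμ.le hρ hxd hmin ht ht1 (hstep w n hw 0 (Nat.zero_le n))).trans
    ((le_max_right _ _).trans (le_max_right _ _))

theorem exists_potential_le_div_sq_of_absolute (hμ : D.μ = 0) (hρ : 0 < D.ρ) (hδ : 0 < D.δ)
    (hr_bot : ∀ x, D.r x ≠ ⊥) (hr_proper : ∃ x, D.r x ≠ ⊤) (ha_sum : ∑ i, D.a i = 1)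
    (hg : StrongConvexOn D.dom D.μ D.realF) (hrule : D.rule = StoppingRule.absolute)
    (hx₁ : D.x₁ ∈ D.dom) {xs : Vec d} (hxs : IsMinimizer D.F xs) :
    ∃ B, ∀ w n, D.Produces w (n + 1) → D.potential xs w n ≤ B / ((n : ℝ) + 1) ^ 2 := by
  obtain ⟨hxd, hmin⟩ := (isMinimizer_iff hr_bot hr_proper).1 hxs
  set K := 2 / 9 * (D.realF D.x₁ - D.realF xs) with hK
  have hK0 : 0 ≤ K := mul_nonneg (by norm_num) (sub_nonneg.2 (hmin _ hx₁))
  -- The tolerance `ℓ^(-(4+δ))` divided by `t` and multiplied by `ℓ²` is again of order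
  -- `ℓ^(-(1+δ/2))`, so both perturbations are summable.
  set t : ℕ → ℝ := fun m => 1 / 2 * (1 / ((m + 1 : ℕ) : ℝ) ^ (1 + D.δ / 2)) with ht_def
  have htpos : ∀ m, 0 < t m := fun m => by positivity
  have htle : ∀ m, t m ≤ 1 / 2 := fun m => by
    refine mul_le_of_le_one_right (by norm_num) ?_
    rw [div_le_one (by positivity)]
    exact Real.one_le_rpow (by simp) (by positivity)
  have htsum : Summable t :=
    ((summable_nat_add_iff 1).2 (Real.summable_one_div_nat_rpow.2
      (show 1 < 1 + D.δ / 2 by linarith))).mul_left _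
  have hstep : ∀ w n, D.Produces w (n + 1) → ∀ k ≤ n,
      ApproxStep D.dom D.realF D.μ D.ρ (D.Y w (k + 1)) (D.X w (k + 2)) (t k)
        (4 * K * t k / ((k : ℝ) + 1) ^ 2) := by
    intro w n hw k hk
    have h1 := hg.approxStep_of_absolute hρ.le (hw.inexactProx_absolute hr_bot hr_proper
      ha_sum hrule hx₁ hxs (show k < n + 1 by omega)) (htpos k) (by linarith [htle k])
    convert h1 using 1
    have hk0 : (0 : ℝ) < (k + 1 : ℕ) := by positivity
    have hp : ((k + 1 : ℕ) : ℝ) ^ (4 + D.δ) =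
        (((k + 1 : ℕ) : ℝ) ^ (1 + D.δ / 2)) ^ 2 * ((k : ℝ) + 1) ^ 2 := by
      rw [← Real.rpow_mul_natCast hk0.le, ← Nat.cast_succ, ← Real.rpow_natCast (((k + 1 : ℕ) : ℝ)) 2,
        ← Real.rpow_add hk0]
      congr 1
      push_cast
      ring
    rw [absFactor, if_neg (by rw [hμ]; exact lt_irrefl _), hp, hK]
    simp only [ht_def]
    field_simp
    ring
  -- The constant is found by unification from the maximum of `0` and the first-step bound, neither
  -- of which involves `w`.
  refine ⟨_, fun w n hw => potential_le_div_sq (St := ∑' m, t (m + 1))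
    (Se := ∑' m, 4 * K * t (m + 1)) hμ.ge hρ hg hxd hmin hμ (le_max_left _ _)
    ((potential_zero_le hμ.ge hρ hxd hmin (htpos 0).le (by linarith [htle 0])
      (hstep w n hw 0 (Nat.zero_le n))).trans (le_max_right _ _)) (t := fun k => t (k + 1))
    (e := fun k => 4 * K * t (k + 1)) (fun k => (htpos _).le) (fun k => htle _)
    (fun k => by have := htpos (k + 1); positivity) (fun k => ?_) (fun k => ?_)
    (fun k hk => (hstep w n hw k hk.le).1) (fun k hk => ?_)⟩
  · exact ((summable_nat_add_iff 1).2 htsum).sum_le_tsum _ fun _ _ => (htpos _).le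
  · refine (((summable_nat_add_iff 1).2 htsum).mul_left _).sum_le_tsum _ fun m _ => ?_
    have := htpos (m + 1)
    positivity
  · have := hstep w n hw (k + 1) hk
    push_cast at this
    rw [show (k : ℝ) + 1 + 1 = k + 2 by ring] at this
    exact this

theorem exists_potential_le_div_sq_of_relative (hμ : D.μ = 0) (hρ : 0 < D.ρ)
    (hr_bot : ∀ x, D.r x ≠ ⊥) (hr_proper : ∃ x, D.r x ≠ ⊤) (ha_sum : ∑ i, D.a i = 1)
    (hg : StrongConvexOn D.dom D.μ D.realF) (hrule : D.rule = StoppingRule.relative)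
    {xs : Vec d} (hxs : IsMinimizer D.F xs) (w : Execution d M) :
    ∃ B, ∀ n, D.Produces w (n + 1) → D.potential xs w n ≤ B / ((n : ℝ) + 1) ^ 2 := by
  obtain ⟨hxd, hmin⟩ := (isMinimizer_iff hr_bot hr_proper).1 hxs
  set t : ℕ → ℝ := fun m => 1 / ((m + 1 : ℕ) : ℝ) ^ 2 with ht_def
  have htpos : ∀ m, 0 < t m := fun m => by positivity
  have htle : ∀ m, t m ≤ 1 := fun m => by
    rw [ht_def, div_le_one (by positivity)]
    exact one_le_pow₀ (by simp)
  have htle' : ∀ m, t (m + 1) ≤ 1 / 2 := fun m => by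
    simp only [ht_def]
    refine one_div_le_one_div_of_le two_pos ?_
    push_cast
    nlinarith [(Nat.cast_nonneg m : (0 : ℝ) ≤ m)]
  have htsum : Summable t :=
    (summable_nat_add_iff 1).2 (Real.summable_one_div_nat_pow.2 one_lt_two)
  have hstep : ∀ n, D.Produces w (n + 1) → ∀ k ≤ n,
      ApproxStep D.dom D.realF D.μ D.ρ (D.Y w (k + 1)) (D.X w (k + 2)) (t k) 0 := by
    intro n hw k hk
    have h1 := hw.inexactProx_relative hr_bot hr_proper ha_sum hrule (show k < n + 1 by omega)
    rw [relFactor, if_neg (by rw [hμ]; exact lt_irrefl _)] at h1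
    exact hg.approxStep_of_relative h1 (htpos k) (htle k)
  -- Here `t 0 = 1`, so `potential_zero_le` does not apply. The initial bound is `|potential xs w
  -- 0|` itself, which is why the constant depends on the realization.
  refine ⟨_, fun n hw => potential_le_div_sq (St := ∑' m, t (m + 1)) (Se := 0) hμ.ge hρ hg hxd
    hmin hμ (abs_nonneg _) (le_abs_self _) (t := fun k => t (k + 1)) (e := fun _ => 0)
    (fun k => (htpos _).le) (fun k => htle' _) (fun _ => le_rfl) (fun k => ?_) (by simp)
    (fun k hk => (hstep n hw k hk.le).1) (fun k hk => ?_)⟩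
  · exact ((summable_nat_add_iff 1).2 htsum).sum_le_tsum _ fun _ _ => (htpos _).le
  · rw [zero_div]
    exact hstep n hw (k + 1) hk

theorem Produces.X_mem_dom (hr_bot : ∀ x, D.r x ≠ ⊥) (hr_proper : ∃ x, D.r x ≠ ⊤)
    (ha_sum : ∑ i, D.a i = 1) (hx₁ : D.rule = StoppingRule.absolute → D.x₁ ∈ D.dom)
    {xs : Vec d} (hxs : IsMinimizer D.F xs) {w : Execution d M} {n : ℕ}
    (h : D.Produces w (n + 1)) : D.X w (n + 2) ∈ D.dom := by
  cases hrule : D.rule with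
  | absolute => exact (h.inexactProx_absolute hr_bot hr_proper ha_sum hrule (hx₁ hrule) hxs
      (Nat.lt_succ_self n)).1
  | relative => exact (h.inexactProx_relative hr_bot hr_proper ha_sum hrule
      (Nat.lt_succ_self n)).1

end CatalystSpy

/-! ### From the potential to the gap and the iterates. -/

theorem mainTheorem6 {d M : ℕ} (D : CatalystSpy d M)
    -- the weights
    (ha : ∀ i, 0 ≤ D.a i) (ha_sum : ∑ i, D.a i = 1)
    -- the functions `fᵢ` are `μ`-strongly convex and `L`-smooth
    (hμ : 0 ≤ D.μ) (hf_conv : ∀ i, StrongConvexOn Set.univ D.μ (D.f i))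
    (hf_smooth : ∀ i, IsSmooth D.L (D.f i))
    -- `r` is a proper convex lower semicontinuous function with values in `ℝ ∪ {+∞}`
    (hr_bot : ∀ x, D.r x ≠ ⊥) (hr_proper : ∃ x, D.r x ≠ ⊤)
    (hr_conv : EpiConvex D.r) (hr_lsc : LowerSemicontinuous D.r)
    -- the parameters of the algorithm
    (hc : 0 < D.c) (hcd : D.c ≤ d) (hδ : 0 < D.δ) (hδ' : D.δ < 1) (hρ : 0 < D.ρ)
    (hγ : 0 < D.γ) (hγ' : D.γ ≤ 2 / (D.μ + D.L + 2 * D.ρ))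
    -- without strong convexity, `F` has a minimizer
    (hmin : D.μ = 0 → ∃ x, IsMinimizer D.F x)
    -- `F(x₁)` is finite if it is used in the stopping criterion
    (hx₁ : D.rule = StoppingRule.absolute → D.r D.x₁ ≠ ⊤)
    -- the random execution
    {Ω : Type*} [MeasurableSpace Ω] (P : Measure Ω) [IsProbabilityMeasure P]
    (W : Ω → Execution d M) (hW : D.IsRandomExecution P W) :
    -- suboptimality at rate `1/ℓ²` along every realization
    (∀ ω, ∃ C : ℝ, ∀ ℓ : ℕ, 1 ≤ ℓ → D.Produces (W ω) ℓ →
      D.F (D.X (W ω) (ℓ + 1)) - ⨅ z, D.F z ≤ ((C / (ℓ : ℝ) ^ 2 : ℝ) : EReal)) ∧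
    -- uniformly over the realizations, except under `C'₃` with `μ = 0`
    ((D.rule = StoppingRule.absolute ∨ 0 < D.μ) →
      ∃ C : ℝ, ∀ ω, ∀ ℓ : ℕ, 1 ≤ ℓ → D.Produces (W ω) ℓ →
        D.F (D.X (W ω) (ℓ + 1)) - ⨅ z, D.F z ≤ ((C / (ℓ : ℝ) ^ 2 : ℝ) : EReal)) ∧
    -- linear convergence of the iterates in the strongly convex case
    (0 < D.μ → ∃ xstar, IsMinimizer D.F xstar ∧ (∀ x, IsMinimizer D.F x → x = xstar) ∧
      ∃ C : ℝ, ∀ ω, ∀ ℓ : ℕ, 1 ≤ ℓ → D.Produces (W ω) ℓ →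
        ‖D.X (W ω) (ℓ + 1) - xstar‖ ^ 2 ≤
          C * (1 - √(D.μ / (4 * D.μ + 4 * D.ρ))) ^ ℓ) := by
  have hg := D.strongConvexOn_realF ha ha_sum hf_conv hr_bot hr_conv
  have hF := D.lowerSemicontinuous_F (fun i => (hf_smooth i).1.continuous) hr_lsc
  obtain ⟨xs, hxs⟩ : ∃ x, IsMinimizer D.F x := hμ.eq_or_lt.elim (fun h => hmin h.symm)
    fun h => CatalystSpy.exists_isMinimizer_F h hr_bot hr_proper hg hF
  obtain ⟨hxd, hxmin⟩ := (CatalystSpy.isMinimizer_iff hr_bot hr_proper).1 hxs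
  have hgeom := fun h : 0 < D.μ =>
    CatalystSpy.exists_potential_le_geometric h hρ hr_bot hr_proper ha_sum hg hx₁ hxs
  have hgap : ∀ w n, D.Produces w (n + 1) →
      D.realF (D.X w (n + 2)) - D.realF xs ≤ D.potential xs w n := fun w n _ =>
    CatalystSpy.realF_sub_le_potential (by linarith) xs w n
  have hcoe : ∀ w n C, D.Produces w (n + 1) → D.potential xs w n ≤ C / ((n : ℝ) + 1) ^ 2 →
      D.F (D.X w (n + 1 + 1)) - ⨅ z, D.F z ≤ ((C / ((n + 1 : ℕ) : ℝ) ^ 2 : ℝ) : EReal) := by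
    intro w n C hw hC
    rw [CatalystSpy.iInf_F_eq hxs, CatalystSpy.F_eq_coe hr_bot hxd,
      CatalystSpy.F_eq_coe hr_bot (hw.X_mem_dom hr_bot hr_proper ha_sum hx₁ hxs),
      ← EReal.coe_sub, EReal.coe_le_coe_iff, Nat.cast_succ]
    exact (hgap w n hw).trans hC
  have hx0 := Real.sqrt_nonneg D.q
  have hx1 : √D.q ≤ 1 := Real.sqrt_le_one.2 (CatalystSpy.q_lt_one hμ hρ).le
  have hunif : D.rule = StoppingRule.absolute ∨ 0 < D.μ →
      ∃ C : ℝ, ∀ w n, D.Produces w (n + 1) → D.potential xs w n ≤ C / ((n : ℝ) + 1) ^ 2 := by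
    intro h
    rcases hμ.eq_or_lt with hμ0 | hμ0
    · have hrule := h.resolve_right hμ0.not_lt
      exact CatalystSpy.exists_potential_le_div_sq_of_absolute hμ0.symm hρ hδ hr_bot hr_proper
        ha_sum hg hrule (hx₁ hrule) hxs
    · obtain ⟨B, hB0, hB⟩ := hgeom hμ0
      have hxpos : 0 < √D.q := Real.sqrt_pos.2 (div_pos hμ0 (by linarith))
      obtain ⟨C, -, hC⟩ := exists_geometric_le_div_sq (r := 1 - √D.q / 2) (by linarith)
        (by linarith)
      refine ⟨B * C, fun w n hw => (hB w n hw).trans ?_⟩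
      rw [mul_div_assoc]
      exact mul_le_mul_of_nonneg_left (hC n) hB0
  refine ⟨fun ω => ?_, fun h => ?_, fun hμ0 => ⟨xs, hxs, fun x hx => ?_, ?_⟩⟩
  · obtain ⟨C, hC⟩ : ∃ C : ℝ, ∀ n, D.Produces (W ω) (n + 1) →
        D.potential xs (W ω) n ≤ C / ((n : ℝ) + 1) ^ 2 := by
      by_cases h : D.rule = StoppingRule.absolute ∨ 0 < D.μ
      · exact (hunif h).imp fun C hC => hC (W ω)
      · rw [not_or, not_lt] at h
        refine CatalystSpy.exists_potential_le_div_sq_of_relative (le_antisymm h.2 hμ) hρ hr_bot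
          hr_proper ha_sum hg ?_ hxs (W ω)
        cases hrule : D.rule with
        | absolute => exact absurd hrule h.1
        | relative => rfl
    refine ⟨C, fun ℓ hℓ hw => ?_⟩
    obtain ⟨n, rfl⟩ := Nat.exists_eq_add_of_le' hℓ
    exact hcoe _ n C hw (hC n hw)
  · obtain ⟨C, hC⟩ := hunif h
    refine ⟨C, fun ω ℓ hℓ hw => ?_⟩
    obtain ⟨n, rfl⟩ := Nat.exists_eq_add_of_le' hℓ
    exact hcoe _ n C hw (hC _ n hw)
  · have hx' := (CatalystSpy.isMinimizer_iff hr_bot hr_proper).1 hx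
    have h1 := hg.sq_norm_le_of_isMinOn hxd hxmin hx'.1
    have h2 := hx'.2 xs hxd
    have h3 : ‖x - xs‖ ^ 2 ≤ 0 := by nlinarith
    exact sub_eq_zero.1 (norm_eq_zero.1 (pow_eq_zero_iff two_ne_zero |>.1
      (le_antisymm h3 (sq_nonneg _))))
  · obtain ⟨B, hB0, hB⟩ := hgeom hμ0
    have hr : 0 < 1 - √D.q / 2 := by linarith
    -- `4 / μ` converts the gap into a squared distance; the division absorbs the shift `ℓ = n + 1`.
    refine ⟨4 / D.μ * B / (1 - √D.q / 2), fun ω ℓ hℓ hw => ?_⟩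
    obtain ⟨n, rfl⟩ := Nat.exists_eq_add_of_le' hℓ
    have h1 := hg.sq_norm_le_of_isMinOn hxd hxmin
      (hw.X_mem_dom hr_bot hr_proper ha_sum hx₁ hxs)
    have h2 := h1.trans ((hgap _ n hw).trans (hB _ n hw))
    rw [show 4 * D.μ + 4 * D.ρ = 4 * (D.μ + D.ρ) by ring, CatalystSpy.sqrt_q_div_two]
    calc ‖D.X (W ω) (n + 2) - xs‖ ^ 2
        = 4 / D.μ * (D.μ / 4 * ‖D.X (W ω) (n + 2) - xs‖ ^ 2) := by field_simp
      _ ≤ 4 / D.μ * (B * (1 - √D.q / 2) ^ n) := by gcongr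
      _ = 4 / D.μ * B / (1 - √D.q / 2) * (1 - √D.q / 2) ^ (n + 1) := by
        rw [pow_succ', ← mul_assoc, ← mul_assoc, div_mul_cancel₀ _ hr.ne']
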